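/- Let $\mu^-<\mu^+$, $\Lambda=(\mu^-,\mu^+)$, $J=\begin{pmatrix}0&1\\-1&0\end{pmatrix}$, $P_\infty=\mathrm{diag}(\mu^-,\mu^+)$, and let $P$ be a continuous map from $(0,+\infty)$ to the real symmetric $2\times2$ matrices such that * $P(x)\to P_\infty$ as $x\to+\infty$, and $\int_1^{\infty}\|P(x)-P_\infty\|^{q_\infty}dx<\infty$ for some $q_\infty\ge1$; * there are $\beta\ge1$, $q_0\ge1$ and a symmetric matrix $P^*$ with $x^\beta P(x)\to P^*$ as $x\to0^+$ and $\int_0^1x^{-\beta}\|x^\beta P(x)-P^*\|^{q_0}dx<\infty$; * $\det P^*<-1/4$ if $\beta=1$, and $\det P^*<0$ if $\beta>1$. Let $\tau z=Jz'+Pz$ and let $A_0$ be the operator $z\mapsto\tau z$ in $L^2(0,+\infty)$ with domain the set of all $\mathbb R^2$-valued, locally absolutely continuous $z\in L^2(0,+\infty)$ with $\tau z\in L^2(0,+\infty)$. An angular coordinate of a nowhere vanishing continuous $z=(u,v)$ is a continuous function $\theta$ on $(0,+\infty)$ with $u=\rho\cos\theta$, $v=\rho\sin\theta$, $\rho>0$;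 the rotation number of $z$ is $\mathrm{rot}(z)=(\theta(+\infty)-\theta(0))/\pi$, where $\theta(+\infty)$ and $\theta(0)$ are the limits of $\theta$ at $+\infty$ and at $0^+$ (when they exist and are finite). It does not depend on the choice of $\theta$. For $\lambda\in\Lambda$ let $\vartheta(\cdot,\lambda)$ be the angular coordinate, normalized by $\vartheta(0)\in[0,\pi)$, of a nontrivial solution of $Jz'+Pz=\lambda z$ on $(0,+\infty)$ that tends to $0$ as $x\to0^+$ (this solution is unique up to a nonzero factor, whose sign is chosen so that the normalization is possible). Put $\nu(\lambda)=\lim_{x\to+\infty}\vartheta(x,\lambda)$ and $$\nu^*(\lambda)=\nu(\lambda)+\arctan\sqrt{\frac{\lambda-\mu^-}{\mu^+-\lambda}} .$$ For $k\in\mathbb Z$ let $\lambda_k\in\Lambda$ be the number (if it exists) with $\nu^*(\lambda_k)=(k+1)\pi$, that is, $$\nu(\lambda_k)=k\pi+\pi-\arctan\sqrt{\frac{\lambda_k-\mu^-}{\mu^+-\lambda_k}},$$ and let $z_k$ be an eigenfunction of $A_0$ for the eigenvalue $\lambda_k$. Let $w_1^*$ be an eigenvector, for the negative eigenvalue, of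 the matrix $C=J^{-1}P^*$ (if $\beta=1$) or $C=\frac1{\beta-1}J^{-1}P^*$ (if $\beta>1$); this eigenvalue is $-\sqrt{-\det P^*}$ or $-\sqrt{-\det P^*}/(\beta-1)$, respectively. Let $\alpha\in[0,\pi)$ be the angle of the line spanned by $w_1^*$, i.e. $\alpha=\arctan(w^*_{1,2}/w^*_{1,1})$ modulo $\pi$. Then, for every $k\in\mathbb Z$ for which $\lambda_k$ exists, the limits that define $\mathrm{rot}(z_k)$ exist and are finite, and $$\mathrm{rot}(z_k)\in(k,k+1)\ \text{ if }\alpha\in(0,\pi/2),\qquad \mathrm{rot}(z_k)\in(k-\tfrac12,k+\tfrac12)\ \text{ if }\alpha\in(\pi/2,\pi).$$ Moreover $\mathrm{rot}(z_k)\ne\mathrm{rot}(z_l)$ for all $k\ne l$ for which $\lambda_k$ and $\lambda_l$ exist. -/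

import Mathlib

open Set Filter Topology MeasureTheory
open scoped Matrix

namespace DiracSystem

noncomputable section

/-- The symplectic matrix `J = (0 1; -1 0)`. -/
def J : Matrix (Fin 2) (Fin 2) ℝ := !![0, 1; -1, 0]

/-- The limit `P_∞ = diag(μ⁻, μ⁺)` of the potential at infinity. -/
def Pinf (μm μp : ℝ) : Matrix (Fin 2) (Fin 2) ℝ := !![μm, 0; 0, μp]

section ClassP

open scoped Matrix.Norms.Frobenius

/-- `P : (0,∞) → M_S²` belongs to the class `𝒫_μ`, the exponent and the matrix that occur in its
behaviour at `0` being `β` and `Pstar`. Only the values of `P` on `(0,∞)` matter. The matrix norm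
is the Frobenius norm (all norms being equivalent, this choice is immaterial). -/
structure ClassP (μm μp : ℝ) (P : ℝ → Matrix (Fin 2) (Fin 2) ℝ) (β : ℝ)
    (Pstar : Matrix (Fin 2) (Fin 2) ℝ) : Prop where
  continuousOn : ContinuousOn P (Ioi 0)
  symm : ∀ x, 0 < x → (P x).IsSymm
  /-- convergence to `P_∞` at infinity -/
  tendsto_atTop : Tendsto P atTop (𝓝 (Pinf μm μp))
  /-- summability of the remainder at infinity -/
  integrable_atTop : ∃ q : ℝ, 1 ≤ q ∧
    IntegrableOn (fun x => ‖P x - Pinf μm μp‖ ^ q) (Ioi 1)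
  one_le_beta : 1 ≤ β
  symm_star : Pstar.IsSymm
  /-- `x ^ β P(x)` converges to `P*` at zero -/
  tendsto_zero : Tendsto (fun x : ℝ => (x ^ β) • P x) (𝓝[>] 0) (𝓝 Pstar)
  /-- summability of the remainder at zero -/
  integrable_zero : ∃ q : ℝ, 1 ≤ q ∧
    IntegrableOn (fun x : ℝ => (1 / x ^ β) * ‖(x ^ β) • P x - Pstar‖ ^ q) (Ioo 0 1)
  det_lt_of_eq : β = 1 → Pstar.det < -1 / 4
  det_lt_of_gt : 1 < β → Pstar.det < 0

end ClassP

/-- Local absolute continuity on `(0,∞)`, i.e. absolute continuity on every compact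
subinterval. -/
def LocallyAC (z : ℝ → Fin 2 → ℝ) : Prop :=
  ∀ a b : ℝ, 0 < a → a ≤ b → AbsolutelyContinuousOnInterval z a b

/-- The differential expression `τ z = J z' + P z`. -/
def tau (P : ℝ → Matrix (Fin 2) (Fin 2) ℝ) (z : ℝ → Fin 2 → ℝ) : ℝ → Fin 2 → ℝ :=
  fun x => J *ᵥ deriv z x + P x *ᵥ z x

/-- `z` is not identically zero on `(0,∞)`. -/
def Nontrivial (z : ℝ → Fin 2 → ℝ) : Prop := ∃ x : ℝ, 0 < x ∧ z x ≠ 0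

/-- `z` is a solution of `J z' + P z = lam z` on `(0,∞)`. -/
def IsSolution (P : ℝ → Matrix (Fin 2) (Fin 2) ℝ) (lam : ℝ) (z : ℝ → Fin 2 → ℝ) : Prop :=
  LocallyAC z ∧ ∀ᵐ x ∂(volume.restrict (Ioi (0 : ℝ))), tau P z x = lam • z x

/-- The domain `D(A₀) = {z ∈ L²(0,∞) : z ∈ AC, τ z ∈ L²(0,∞)}` of the self-adjoint
realization `A₀` of `τ`. -/
def MemDomain (P : ℝ → Matrix (Fin 2) (Fin 2) ℝ) (z : ℝ → Fin 2 → ℝ) : Prop :=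
  MemLp z 2 (volume.restrict (Ioi (0 : ℝ))) ∧ LocallyAC z ∧
    MemLp (tau P z) 2 (volume.restrict (Ioi (0 : ℝ)))

/-- `z` is an eigenfunction of `A₀` for the eigenvalue `lam`: it is a nonzero element of `D(A₀)`
and `A₀ z = lam z` in `L²(0,∞)`. -/
def IsEigenfunction (P : ℝ → Matrix (Fin 2) (Fin 2) ℝ) (lam : ℝ) (z : ℝ → Fin 2 → ℝ) : Prop :=
  MemDomain P z ∧ Nontrivial z ∧
    ∀ᵐ x ∂(volume.restrict (Ioi (0 : ℝ))), tau P z x = lam • z x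

/-- `θ` is an angular coordinate of `z = (u, v)` on `(0,∞)`: it is continuous there, and
`u = ρ cos θ`, `v = ρ sin θ` with `ρ > 0`. -/
def IsAngularCoordinate (z : ℝ → Fin 2 → ℝ) (θ : ℝ → ℝ) : Prop :=
  ContinuousOn θ (Ioi 0) ∧ ∀ x, 0 < x → ∃ ρ : ℝ, 0 < ρ ∧
    z x 0 = ρ * Real.cos (θ x) ∧ z x 1 = ρ * Real.sin (θ x)

/-- `r = (θ(+∞) - θ(0)) / π` for some angular coordinate `θ` of `z` that has finite limits
`θ(0)` at zero and `θ(+∞)` at infinity. -/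
def HasRotationNumber (z : ℝ → Fin 2 → ℝ) (r : ℝ) : Prop :=
  ∃ (θ : ℝ → ℝ) (a b : ℝ), IsAngularCoordinate z θ ∧ Tendsto θ (𝓝[>] 0) (𝓝 a) ∧
    Tendsto θ atTop (𝓝 b) ∧ r = (b - a) / Real.pi

/-- The rotation number does not depend on the choice of the angular coordinate. -/
theorem HasRotationNumber.unique {z : ℝ → Fin 2 → ℝ} {r s : ℝ} (hr : HasRotationNumber z r)
    (hs : HasRotationNumber z s) : r = s := by
  obtain ⟨θ, a, b, ⟨hθ, hz⟩, ha, hb, rfl⟩ := hr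
  obtain ⟨φ, c, d, ⟨hφ, hw⟩, hc, hd, rfl⟩ := hs
  have key : ∀ x, 0 < x → ∃ n : ℤ, θ x - φ x = n * (2 * Real.pi) := by
    intro x hx
    obtain ⟨ρ, hρ, h0, h1⟩ := hz x hx
    obtain ⟨σ, hσ, k0, k1⟩ := hw x hx
    have e0 : ρ * Real.cos (θ x) = σ * Real.cos (φ x) := h0.symm.trans k0
    have e1 : ρ * Real.sin (θ x) = σ * Real.sin (φ x) := h1.symm.trans k1
    have hsq : ρ ^ 2 = σ ^ 2 := by
      have t1 := Real.sin_sq_add_cos_sq (θ x)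
      have t2 := Real.sin_sq_add_cos_sq (φ x)
      calc ρ ^ 2 = (ρ * Real.cos (θ x)) ^ 2 + (ρ * Real.sin (θ x)) ^ 2 := by
            linear_combination (-ρ ^ 2) * t1
        _ = (σ * Real.cos (φ x)) ^ 2 + (σ * Real.sin (φ x)) ^ 2 := by rw [e0, e1]
        _ = σ ^ 2 := by linear_combination (σ ^ 2) * t2
    have hρσ : ρ = σ := by
      rcases sq_eq_sq_iff_eq_or_eq_neg.mp hsq with h | h
      · exact h
      · linarith
    subst hρσ
    have c0 := mul_left_cancel₀ hρ.ne' e0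
    have s0 := mul_left_cancel₀ hρ.ne' e1
    have hc1 : Real.cos (θ x - φ x) = 1 := by
      rw [Real.cos_sub, c0, s0]
      linear_combination Real.sin_sq_add_cos_sq (φ x)
    obtain ⟨n, hn⟩ := (Real.cos_eq_one_iff _).mp hc1
    exact ⟨n, hn.symm⟩
  have hcont : ContinuousOn (fun x => (θ x - φ x) / (2 * Real.pi)) (Ioi 0) :=
    (hθ.sub hφ).div_const _
  have hint : ∀ x ∈ Ioi (0 : ℝ), (θ x - φ x) / (2 * Real.pi) ∈ range ((↑) : ℤ → ℝ) := by
    intro x hx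
    obtain ⟨n, hn⟩ := key x hx
    refine ⟨n, ?_⟩
    rw [hn]
    field_simp
  have hsub : ((fun x => (θ x - φ x) / (2 * Real.pi)) '' Ioi 0).Subsingleton := by
    have hpre : IsPreconnected ((fun x => (θ x - φ x) / (2 * Real.pi)) '' Ioi 0) :=
      isPreconnected_Ioi.image _ hcont
    have hcount : ((fun x => (θ x - φ x) / (2 * Real.pi)) '' Ioi 0).Countable := by
      refine (countable_range ((↑) : ℤ → ℝ)).mono ?_
      rintro _ ⟨x, hx, rfl⟩
      exact hint x hx
    exact hcount.isTotallyDisconnected _ subset_rfl hpre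
  have hconst : ∀ x, 0 < x → θ x - φ x = θ 1 - φ 1 := by
    intro x hx
    have h := hsub ⟨x, hx, rfl⟩ ⟨1, mem_Ioi.mpr one_pos, rfl⟩
    have hpi := Real.pi_pos
    simp only at h
    field_simp at h
    exact h
  have l0 : a - c = θ 1 - φ 1 := by
    refine tendsto_nhds_unique (ha.sub hc) (tendsto_const_nhds.congr' ?_)
    filter_upwards [self_mem_nhdsWithin] with x hx using (hconst x hx).symm
  have l1 : b - d = θ 1 - φ 1 := by
    refine tendsto_nhds_unique (hb.sub hd) (tendsto_const_nhds.congr' ?_)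
    filter_upwards [eventually_gt_atTop 0] with x hx using (hconst x hx).symm
  have : b - a = d - c := by linarith
  rw [this]

/-- The rotation number `rot(z)`: the number `r` with `HasRotationNumber z r`, which is unique if
it exists (the value is meaningless if it does not). -/
def rot (z : ℝ → Fin 2 → ℝ) : ℝ := Classical.epsilon (HasRotationNumber z)

/-- `ζ` is a nontrivial solution of `J z' + P z = lam z` on `(0,∞)` that tends to `0` at `0`, that
is, a nonzero multiple of the solution `ζ_{1,lam}` that is recessive at `0`. -/
def IsRecessiveAtZero (P : ℝ → Matrix (Fin 2) (Fin 2) ℝ) (lam : ℝ) (ζ : ℝ → Fin 2 → ℝ) : Prop :=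
  IsSolution P lam ζ ∧ Nontrivial ζ ∧ Tendsto ζ (𝓝[>] 0) (𝓝 0)

/-- `c` is the limit at infinity of the angular coordinate `ϑ(·, lam)` of the solution that is
recessive at `0`, this coordinate being normalized by `ϑ(0) ∈ [0, π)`. -/
def HasNu (P : ℝ → Matrix (Fin 2) (Fin 2) ℝ) (lam c : ℝ) : Prop :=
  ∃ (ζ : ℝ → Fin 2 → ℝ) (θ : ℝ → ℝ) (a : ℝ), IsRecessiveAtZero P lam ζ ∧
    IsAngularCoordinate ζ θ ∧ Tendsto θ (𝓝[>] 0) (𝓝 a) ∧ a ∈ Ico 0 Real.pi ∧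
    Tendsto θ atTop (𝓝 c)

/-- The function `ν(lam) = lim_{x → +∞} ϑ(x, lam)`. -/
def nu (P : ℝ → Matrix (Fin 2) (Fin 2) ℝ) (lam : ℝ) : ℝ := Classical.epsilon (HasNu P lam)

/-- The function `ν*(lam) = ν(lam) + arctan √((lam - μ⁻) / (μ⁺ - lam))`. -/
def nuStar (μm μp : ℝ) (P : ℝ → Matrix (Fin 2) (Fin 2) ℝ) (lam : ℝ) : ℝ :=
  nu P lam + Real.arctan (Real.sqrt ((lam - μm) / (μp - lam)))

/-- `lam` is the `k`-th eigenvalue `λ_k ∈ (μ⁻, μ⁺)`: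
`ν(λ_k) = k π + π - arctan √((λ_k - μ⁻) / (μ⁺ - λ_k))`. -/
def IsKthEigenvalue (μm μp : ℝ) (P : ℝ → Matrix (Fin 2) (Fin 2) ℝ) (k : ℤ) (lam : ℝ) : Prop :=
  lam ∈ Ioo μm μp ∧ nuStar μm μp P lam = (k + 1) * Real.pi

/-- The coefficient matrix `C` of the system at `0`, after the change of variable that sends the
singularity to infinity: `J⁻¹ P*` if `β = 1` and `J⁻¹ P* / (β - 1)` if `β > 1`. -/
def Cmat (β : ℝ) (Pstar : Matrix (Fin 2) (Fin 2) ℝ) : Matrix (Fin 2) (Fin 2) ℝ :=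
  if β = 1 then J⁻¹ * Pstar else (1 / (β - 1)) • (J⁻¹ * Pstar)

/-- The negative eigenvalue of `C`: `-√(-det P*)` if `β = 1` and `-√(-det P*) / (β - 1)` if
`β > 1`. -/
def sigmaMinus (β : ℝ) (Pstar : Matrix (Fin 2) (Fin 2) ℝ) : ℝ :=
  if β = 1 then -Real.sqrt (-Pstar.det) else -Real.sqrt (-Pstar.det) / (β - 1)

/-- `α ∈ [0, π)` is the angle of the line spanned by the nonzero vector `w`, that is, the value
modulo `π` of `arctan (w₂ / w₁)` in `[0, π)`. -/
def IsLineAngle (w : Fin 2 → ℝ) (α : ℝ) : Prop :=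
  α ∈ Ico 0 Real.pi ∧ ∃ ρ : ℝ, ρ ≠ 0 ∧ w 0 = ρ * Real.cos α ∧ w 1 = ρ * Real.sin α

end

end DiracSystem

open DiracSystem

namespace DiracSystem

/-! ### Regularity of solutions -/

/-! In polar coordinates `u + iv = exp (R + iθ)` a solution satisfies `θ' = Q(θ)` and `R' = -Q'(θ) /
2`, where `Q` is the quadratic form of `λ - P(x)` on the unit circle. After suitable rescaling `Q`
has an indefinite limit at both ends: `diag(λ - μ⁻, λ - μ⁺)` at infinity, and, with `x = exp (-t)`,
the form of `P*` at zero. Levels where the limiting form is nonzero can eventually be crossed in one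
direction only, so `θ` converges, and its limit is a null direction of that form
(`IsAngularFlow.exists_tendsto`).

At a null direction of `P*` the radial rate in `t` is `±√(-det P*)`. The plus sign forces `|z|² ≥ c
/ x` near zero, which square integrability excludes; the condition `det P* < -1/4` for `β = 1`
serves exactly this. With the minus sign `z` tends to `0`, and the null direction is the
eigendirection of `J⁻¹ P*` for its negative eigenvalue, so `θ(0) = α` modulo `π` (`exists_angle`).
Recessive solutions are proportional, hence `rot(z) = (ν(λ) - α) / π`, and for `λ = λ_k` this reads
`π rot(z_k) = (k + 1) π - φ - α` with `φ ∈ (0, π/2)` (`rot_eigenfunction_eq`). Both inclusions and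
the distinctness are read off from this identity. -/

theorem hasDerivAt_integral_of_pos {F : ℝ → ℝ} (hF : ContinuousOn F (Ioi 0)) {a x : ℝ}
    (ha : 0 < a) (hx : 0 < x) : HasDerivAt (fun y => ∫ t in a..y, F t) (F x) x := by
  refine intervalIntegral.integral_hasDerivAt_right ?_ ?_ (hF.continuousAt (Ioi_mem_nhds hx))
  · refine (hF.mono fun t ht => ?_).intervalIntegrable
    exact lt_of_lt_of_le (lt_min ha hx) ht.1
  · exact hF.stronglyMeasurableAtFilter isOpen_Ioi x hx

/-- By absolute continuity `f` is the integral of its derivative, hence of the continuous `F`, and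
the fundamental theorem of calculus applies at every point. The base point `x / 2` keeps the
interval inside `(0, ∞)`. -/
theorem hasDerivAt_of_ae_deriv_eq {f F : ℝ → ℝ}
    (hf : ∀ a b : ℝ, 0 < a → a ≤ b → AbsolutelyContinuousOnInterval f a b)
    (hF : ContinuousOn F (Ioi 0))
    (h : ∀ᵐ x ∂(volume.restrict (Ioi (0 : ℝ))), deriv f x = F x) {x : ℝ} (hx : 0 < x) :
    HasDerivAt f (F x) x := by
  have hx2 : 0 < x / 2 := by positivity
  refine ((hasDerivAt_integral_of_pos hF hx2 hx).const_add (f (x / 2))).congr_of_eventuallyEq ?_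
  filter_upwards [Ioi_mem_nhds (half_lt_self hx)] with y hy
  have hy' : x / 2 < y := hy
  have key := (hf (x / 2) y hx2 hy'.le).integral_deriv_eq_sub
  have hint : ∫ t in (x / 2)..y, deriv f t = ∫ t in (x / 2)..y, F t := by
    refine intervalIntegral.integral_congr_ae ?_
    filter_upwards [(ae_restrict_iff' measurableSet_Ioi).mp h] with t ht hmem
    rw [uIoc_of_le hy'.le] at hmem
    exact ht (hx2.trans hmem.1)
  rw [← hint, key]
  ring

theorem LocallyAC.apply {z : ℝ → Fin 2 → ℝ} (hz : LocallyAC z) (i : Fin 2) {a b : ℝ}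
    (ha : 0 < a) (hab : a ≤ b) : AbsolutelyContinuousOnInterval (fun x => z x i) a b := by
  refine squeeze_zero (fun E => Finset.sum_nonneg fun _ _ => dist_nonneg)
    (fun E => Finset.sum_le_sum fun j _ => ?_) (hz a b ha hab)
  exact dist_le_pi_dist _ _ i

/-- `deriv z` has the default value `0` where one component fails to be differentiable, so the
components agree only almost everywhere. Absolutely continuous functions have bounded variation, and
the intervals `[1 / (n + 1), n + 1]` exhaust `(0, ∞)`. -/
theorem LocallyAC.ae_deriv_apply {z : ℝ → Fin 2 → ℝ} (hz : LocallyAC z) :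
    ∀ᵐ x ∂(volume.restrict (Ioi (0 : ℝ))), ∀ i, deriv z x i = deriv (fun y => z y i) x := by
  have h : ∀ n : ℕ, ∀ i : Fin 2, ∀ᵐ x : ℝ, x ∈ uIcc (1 / ((n : ℝ) + 1)) ((n : ℝ) + 1) →
      DifferentiableAt ℝ (fun y => z y i) x := by
    intro n i
    have h1 : (0 : ℝ) < (n : ℝ) + 1 := by positivity
    have h2 : 1 / ((n : ℝ) + 1) ≤ (n : ℝ) + 1 := by
      rw [div_le_iff₀ h1]
      nlinarith [(Nat.cast_nonneg n : (0 : ℝ) ≤ n)]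
    exact (hz.apply i (by positivity) h2).boundedVariationOn.ae_differentiableAt_of_mem_uIcc
  rw [ae_restrict_iff' measurableSet_Ioi]
  filter_upwards [ae_all_iff.mpr fun n => ae_all_iff.mpr fun i => h n i] with x hx hx0 i
  have hx0' : (0 : ℝ) < x := hx0
  obtain ⟨n, hn⟩ := exists_nat_ge (max x (1 / x))
  have h1 : x ≤ n := (le_max_left _ _).trans hn
  have h2 : 1 / x ≤ n := (le_max_right _ _).trans hn
  have hmem : x ∈ uIcc (1 / ((n : ℝ) + 1)) ((n : ℝ) + 1) := by
    refine mem_uIcc_of_le ?_ (by linarith)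
    rw [div_le_iff₀ (by positivity)]
    rw [div_le_iff₀ hx0'] at h2
    nlinarith
  have hd : HasDerivAt z (fun i => deriv (fun y => z y i) x) x :=
    hasDerivAt_pi.mpr fun i => (hx n i hmem).hasDerivAt
  rw [hd.deriv]

/-- The componentwise form of `J z' + P z = lam z` for a symmetric matrix with entries
`p`, `r`, `q`. -/
def IsClassicalSolution (p r q : ℝ → ℝ) (lam : ℝ) (u v : ℝ → ℝ) : Prop :=
  ∀ x, 0 < x → HasDerivAt u (r x * u x + (q x - lam) * v x) x ∧
    HasDerivAt v ((lam - p x) * u x - r x * v x) x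

theorem IsSolution.isClassicalSolution {P : ℝ → Matrix (Fin 2) (Fin 2) ℝ} {lam : ℝ}
    {z : ℝ → Fin 2 → ℝ} (hP : ContinuousOn P (Ioi 0)) (hsymm : ∀ x, 0 < x → (P x).IsSymm)
    (hz : IsSolution P lam z) :
    IsClassicalSolution (fun x => P x 0 0) (fun x => P x 0 1) (fun x => P x 1 1) lam
      (fun x => z x 0) (fun x => z x 1) := by
  obtain ⟨hac, hτ⟩ := hz
  have hPc : ∀ i j, ContinuousOn (fun x => P x i j) (Ioi 0) := fun i j =>
    (continuous_apply_apply i j).comp_continuousOn hP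
  have hzc : ∀ i, ContinuousOn (fun x => z x i) (Ioi 0) := by
    intro i x hx
    have hx0 : (0 : ℝ) < x := hx
    have hc := (hac.apply i (half_pos hx0) (by linarith : x / 2 ≤ 2 * x)).continuousOn
    refine (hc.continuousAt ?_).continuousWithinAt
    rw [uIcc_of_le (by linarith)]
    exact Icc_mem_nhds (by linarith) (by linarith)
  have hboth : ∀ᵐ x ∂(volume.restrict (Ioi (0 : ℝ))),
      deriv (fun y => z y 0) x = P x 0 1 * z x 0 + (P x 1 1 - lam) * z x 1 ∧
      deriv (fun y => z y 1) x = (lam - P x 0 0) * z x 0 - P x 0 1 * z x 1 := by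
    filter_upwards [hτ, hac.ae_deriv_apply, ae_restrict_mem measurableSet_Ioi] with x h1 h2 h3
    have e0 := congrFun h1 0
    have e1 := congrFun h1 1
    have hs : P x 1 0 = P x 0 1 := (hsymm x h3).apply 0 1
    simp only [tau, J, Pi.add_apply, Pi.smul_apply, smul_eq_mul, Matrix.mulVec, dotProduct,
      Fin.sum_univ_two, Matrix.of_apply, Matrix.cons_val', Matrix.cons_val_zero,
      Matrix.cons_val_one, Matrix.cons_val_fin_one, hs] at e0 e1
    rw [← h2 0, ← h2 1]
    constructor <;> linarith
  intro x hx
  constructor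
  · refine hasDerivAt_of_ae_deriv_eq (F := fun x => P x 0 1 * z x 0 + (P x 1 1 - lam) * z x 1)
      (fun a b ha hab => hac.apply 0 ha hab) ?_ (hboth.mono fun y hy => hy.1) hx
    exact ((hPc 0 1).mul (hzc 0)).add (((hPc 1 1).sub continuousOn_const).mul (hzc 1))
  · refine hasDerivAt_of_ae_deriv_eq (F := fun x => (lam - P x 0 0) * z x 0 - P x 0 1 * z x 1)
      (fun a b ha hab => hac.apply 1 ha hab) ?_ (hboth.mono fun y hy => hy.2) hx
    exact ((continuousOn_const.sub (hPc 0 0)).mul (hzc 0)).sub ((hPc 0 1).mul (hzc 1))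

/-! ### Nontrivial solutions do not vanish -/

/-- A Grönwall argument in both directions: `E = u² + v²` satisfies `|E'| ≤ k E`, so with `M' = k`
the function `E exp M` increases and `E exp (-M)` decreases. Positivity at `x₁` thus propagates to
the right and to the left. -/
theorem IsClassicalSolution.sq_add_sq_pos {p r q : ℝ → ℝ} {lam : ℝ} {u v : ℝ → ℝ}
    (hp : ContinuousOn p (Ioi 0)) (hr : ContinuousOn r (Ioi 0)) (hq : ContinuousOn q (Ioi 0))
    (h : IsClassicalSolution p r q lam u v) {x₁ : ℝ} (hx₁ : 0 < x₁)
    (hne : u x₁ ≠ 0 ∨ v x₁ ≠ 0) {x : ℝ} (hx : 0 < x) : 0 < u x ^ 2 + v x ^ 2 := by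
  set k : ℝ → ℝ := fun x => 2 * |r x| + |q x - p x| with hk
  have hkc : ContinuousOn k (Ioi 0) :=
    (continuousOn_const.mul hr.abs).add (hq.sub hp).abs
  set M : ℝ → ℝ := fun y => ∫ t in (1 : ℝ)..y, k t with hM
  have hMd : ∀ y, 0 < y → HasDerivAt M (k y) y := fun y hy =>
    hasDerivAt_integral_of_pos hkc one_pos hy
  set E : ℝ → ℝ := fun y => u y ^ 2 + v y ^ 2 with hE
  have hEd : ∀ y, 0 < y →
      HasDerivAt E (2 * (r y * (u y ^ 2 - v y ^ 2) + (q y - p y) * (u y * v y))) y := by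
    intro y hy
    refine (((h y hy).1.pow 2).add ((h y hy).2.pow 2)).congr_deriv ?_
    push_cast
    ring
  have hbound : ∀ y, |2 * (r y * (u y ^ 2 - v y ^ 2) + (q y - p y) * (u y * v y))| ≤
      k y * E y := by
    intro y
    have h1 : |u y ^ 2 - v y ^ 2| ≤ E y :=
      abs_le.mpr ⟨by simp only [hE]; nlinarith [sq_nonneg (u y)],
        by simp only [hE]; nlinarith [sq_nonneg (v y)]⟩
    have h2 : 2 * |u y * v y| ≤ E y := by
      rw [abs_mul]
      simp only [hE]
      nlinarith [sq_nonneg (|u y| - |v y|), sq_abs (u y), sq_abs (v y)]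
    have h3 : |r y * (u y ^ 2 - v y ^ 2) + (q y - p y) * (u y * v y)| ≤
        |r y| * |u y ^ 2 - v y ^ 2| + |q y - p y| * |u y * v y| := by
      rw [← abs_mul, ← abs_mul]
      exact abs_add_le _ _
    rw [abs_mul, abs_two]
    simp only [hk]
    nlinarith [mul_le_mul_of_nonneg_left h1 (abs_nonneg (r y)),
      mul_le_mul_of_nonneg_left h2 (abs_nonneg (q y - p y))]
  have hmono : MonotoneOn (fun y => E y * Real.exp (M y)) (Ioi 0) := by
    have hd : ∀ y, 0 < y → HasDerivAt (fun y => E y * Real.exp (M y)) _ y := fun y hy =>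
      (hEd y hy).mul (hMd y hy).exp
    refine monotoneOn_of_deriv_nonneg (convex_Ioi 0)
      (fun y hy => (hd y hy).continuousAt.continuousWithinAt)
      (fun y hy => (hd y (interior_subset hy)).differentiableAt.differentiableWithinAt) ?_
    intro y hy
    rw [(hd y (interior_subset hy)).deriv]
    nlinarith [(abs_le.mp (hbound y)).1, Real.exp_pos (M y)]
  have hanti : AntitoneOn (fun y => E y * Real.exp (-M y)) (Ioi 0) := by
    have hd : ∀ y, 0 < y → HasDerivAt (fun y => E y * Real.exp (-M y)) _ y := fun y hy =>
      (hEd y hy).mul (hMd y hy).neg.exp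
    refine antitoneOn_of_deriv_nonpos (convex_Ioi 0)
      (fun y hy => (hd y hy).continuousAt.continuousWithinAt)
      (fun y hy => (hd y (interior_subset hy)).differentiableAt.differentiableWithinAt) ?_
    intro y hy
    rw [(hd y (interior_subset hy)).deriv, Pi.neg_apply]
    nlinarith [(abs_le.mp (hbound y)).2, Real.exp_pos (-M y)]
  have hE1 : 0 < E x₁ := by
    simp only [hE]
    rcases hne with h0 | h0
    · have := pow_pos (abs_pos.mpr h0) 2
      rw [sq_abs] at this
      positivity
    · have := pow_pos (abs_pos.mpr h0) 2
      rw [sq_abs] at this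
      positivity
  rcases le_total x₁ x with hle | hle
  · have := hmono (mem_Ioi.mpr hx₁) (mem_Ioi.mpr hx) hle
    have hpos : 0 < E x * Real.exp (M x) :=
      lt_of_lt_of_le (mul_pos hE1 (Real.exp_pos _)) this
    exact pos_of_mul_pos_left hpos (Real.exp_pos _).le
  · have := hanti (mem_Ioi.mpr hx) (mem_Ioi.mpr hx₁) hle
    have hpos : 0 < E x * Real.exp (-M x) :=
      lt_of_lt_of_le (mul_pos hE1 (Real.exp_pos _)) this
    exact pos_of_mul_pos_left hpos (Real.exp_pos _).le

/-! ### Polar coordinates -/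

/-- The quadratic form `a u² + 2 b u v + d v²` on the unit circle. -/
noncomputable def circleForm (a b d θ : ℝ) : ℝ :=
  a * Real.cos θ ^ 2 + 2 * b * (Real.cos θ * Real.sin θ) + d * Real.sin θ ^ 2

/-- Minus one half of the derivative of `circleForm a b d`. -/
noncomputable def radialForm (a b d θ : ℝ) : ℝ :=
  -b * (Real.cos θ ^ 2 - Real.sin θ ^ 2) + (a - d) * (Real.cos θ * Real.sin θ)

/-- `R + iθ` is obtained by integrating the logarithmic derivative `a + ib = (f + ig) / (u + iv)`
from `x = 1`. Then `F + iG = exp (-R - iθ) (u + iv)` has zero derivative and equals `1` at `x = 1`.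
-/
theorem exists_polar {u v f g : ℝ → ℝ} (hf : ContinuousOn f (Ioi 0))
    (hg : ContinuousOn g (Ioi 0)) (hu : ∀ x, 0 < x → HasDerivAt u (f x) x)
    (hv : ∀ x, 0 < x → HasDerivAt v (g x) x) (hne : ∀ x, 0 < x → 0 < u x ^ 2 + v x ^ 2) :
    ∃ R θ : ℝ → ℝ, (∀ x, 0 < x → u x = Real.exp (R x) * Real.cos (θ x) ∧
      v x = Real.exp (R x) * Real.sin (θ x)) ∧
      (∀ x, 0 < x → HasDerivAt R ((u x * f x + v x * g x) / (u x ^ 2 + v x ^ 2)) x) ∧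
      (∀ x, 0 < x → HasDerivAt θ ((u x * g x - v x * f x) / (u x ^ 2 + v x ^ 2)) x) := by
  have huc : ContinuousOn u (Ioi 0) := fun x hx => (hu x hx).continuousAt.continuousWithinAt
  have hvc : ContinuousOn v (Ioi 0) := fun x hx => (hv x hx).continuousAt.continuousWithinAt
  have hEc : ContinuousOn (fun x => u x ^ 2 + v x ^ 2) (Ioi 0) := (huc.pow 2).add (hvc.pow 2)
  set a : ℝ → ℝ := fun x => (u x * f x + v x * g x) / (u x ^ 2 + v x ^ 2) with ha
  set b : ℝ → ℝ := fun x => (u x * g x - v x * f x) / (u x ^ 2 + v x ^ 2) with hb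
  have hac : ContinuousOn a (Ioi 0) :=
    ((huc.mul hf).add (hvc.mul hg)).div hEc fun x hx => (hne x hx).ne'
  have hbc : ContinuousOn b (Ioi 0) :=
    ((huc.mul hg).sub (hvc.mul hf)).div hEc fun x hx => (hne x hx).ne'
  set ζ : ℂ := ⟨u 1, v 1⟩ with hζ
  have hζ0 : 0 < ‖ζ‖ := by
    rw [norm_pos_iff]
    intro h0
    have h1 := hne 1 one_pos
    have h2 : u 1 = 0 := congrArg Complex.re h0
    have h3 : v 1 = 0 := congrArg Complex.im h0
    rw [h2, h3] at h1
    norm_num at h1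
  set R : ℝ → ℝ := fun y => Real.log ‖ζ‖ + ∫ t in (1 : ℝ)..y, a t with hR
  set θ : ℝ → ℝ := fun y => ζ.arg + ∫ t in (1 : ℝ)..y, b t with hθ
  have hRd : ∀ x, 0 < x → HasDerivAt R (a x) x := fun x hx =>
    (hasDerivAt_integral_of_pos hac one_pos hx).const_add _
  have hθd : ∀ x, 0 < x → HasDerivAt θ (b x) x := fun x hx =>
    (hasDerivAt_integral_of_pos hbc one_pos hx).const_add _
  set F : ℝ → ℝ := fun x => Real.exp (-R x) * (u x * Real.cos (θ x) + v x * Real.sin (θ x))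
    with hF
  set G : ℝ → ℝ := fun x => Real.exp (-R x) * (v x * Real.cos (θ x) - u x * Real.sin (θ x))
    with hG
  have hab : ∀ x, 0 < x → u x * a x - v x * b x = f x ∧ v x * a x + u x * b x = g x := by
    intro x hx
    have := (hne x hx).ne'
    constructor
    · simp only [ha, hb]; field_simp; ring
    · simp only [ha, hb]; field_simp; ring
  have hFd : ∀ x, 0 < x → HasDerivAt F 0 x := by
    intro x hx
    refine ((hRd x hx).neg.exp.mul (((hu x hx).mul (hθd x hx).cos).add
      ((hv x hx).mul (hθd x hx).sin))).congr_deriv ?_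
    obtain ⟨h1, h2⟩ := hab x hx
    rw [← h1, ← h2]
    simp only [Pi.neg_apply, Pi.add_apply, Pi.mul_apply]
    ring
  have hGd : ∀ x, 0 < x → HasDerivAt G 0 x := by
    intro x hx
    refine ((hRd x hx).neg.exp.mul (((hv x hx).mul (hθd x hx).cos).sub
      ((hu x hx).mul (hθd x hx).sin))).congr_deriv ?_
    obtain ⟨h1, h2⟩ := hab x hx
    rw [← h1, ← h2]
    simp only [Pi.neg_apply, Pi.sub_apply, Pi.mul_apply]
    ring
  have hconst : ∀ H : ℝ → ℝ, (∀ x, 0 < x → HasDerivAt H 0 x) → ∀ x, 0 < x → H x = H 1 := by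
    intro H hH x hx
    refine isOpen_Ioi.is_const_of_deriv_eq_zero isPreconnected_Ioi
      (fun y hy => (hH y hy).differentiableAt.differentiableWithinAt)
      (fun y hy => (hH y hy).deriv) (mem_Ioi.mpr hx) (mem_Ioi.mpr one_pos)
  have hR1 : R 1 = Real.log ‖ζ‖ := by simp [hR]
  have hθ1 : θ 1 = ζ.arg := by simp [hθ]
  have hu1 : u 1 = ‖ζ‖ * Real.cos ζ.arg := by
    rw [Complex.norm_mul_cos_arg]
  have hv1 : v 1 = ‖ζ‖ * Real.sin ζ.arg := by
    rw [Complex.norm_mul_sin_arg]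
  have hF1 : F 1 = 1 := by
    simp only [hF, hR1, hθ1, Real.exp_neg, Real.exp_log hζ0]
    rw [hu1, hv1]
    field_simp
    linarith [Real.sin_sq_add_cos_sq ζ.arg]
  have hG1 : G 1 = 0 := by
    simp only [hG, hR1, hθ1]
    rw [hu1, hv1]
    ring
  refine ⟨R, θ, fun x hx => ?_, hRd, hθd⟩
  have e1 : Real.exp (-R x) * (u x * Real.cos (θ x) + v x * Real.sin (θ x)) = 1 :=
    (hconst F hFd x hx).trans hF1
  have e2 : Real.exp (-R x) * (v x * Real.cos (θ x) - u x * Real.sin (θ x)) = 0 :=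
    (hconst G hGd x hx).trans hG1
  have e3 : Real.exp (R x) * Real.exp (-R x) = 1 := by
    rw [← Real.exp_add, add_neg_cancel, Real.exp_zero]
  have e4 := Real.sin_sq_add_cos_sq (θ x)
  have e5 : u x * Real.cos (θ x) + v x * Real.sin (θ x) = Real.exp (R x) := by
    linear_combination Real.exp (R x) * e1 - (u x * Real.cos (θ x) + v x * Real.sin (θ x)) * e3
  have e6 : v x * Real.cos (θ x) - u x * Real.sin (θ x) = 0 := by
    linear_combination Real.exp (R x) * e2 - (v x * Real.cos (θ x) - u x * Real.sin (θ x)) * e3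
  constructor
  · linear_combination Real.cos (θ x) * e5 - Real.sin (θ x) * e6 - u x * e4
  · linear_combination Real.sin (θ x) * e5 + Real.cos (θ x) * e6 - v x * e4

theorem IsClassicalSolution.exists_polar {p r q : ℝ → ℝ} {lam : ℝ} {u v : ℝ → ℝ}
    (hp : ContinuousOn p (Ioi 0)) (hr : ContinuousOn r (Ioi 0)) (hq : ContinuousOn q (Ioi 0))
    (h : IsClassicalSolution p r q lam u v) {x₁ : ℝ} (hx₁ : 0 < x₁)
    (hne : u x₁ ≠ 0 ∨ v x₁ ≠ 0) :
    ∃ R θ : ℝ → ℝ, (∀ x, 0 < x → u x = Real.exp (R x) * Real.cos (θ x) ∧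
      v x = Real.exp (R x) * Real.sin (θ x)) ∧
      (∀ x, 0 < x → HasDerivAt R (radialForm (lam - p x) (-r x) (lam - q x) (θ x)) x) ∧
      (∀ x, 0 < x → HasDerivAt θ (circleForm (lam - p x) (-r x) (lam - q x) (θ x)) x) := by
  have huc : ContinuousOn u (Ioi 0) := fun x hx => (h x hx).1.continuousAt.continuousWithinAt
  have hvc : ContinuousOn v (Ioi 0) := fun x hx => (h x hx).2.continuousAt.continuousWithinAt
  obtain ⟨R, θ, hpol, hR, hθ⟩ := DiracSystem.exists_polar
    ((hr.mul huc).add ((hq.sub continuousOn_const).mul hvc))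
    (((continuousOn_const.sub hp).mul huc).sub (hr.mul hvc))
    (fun x hx => (h x hx).1) (fun x hx => (h x hx).2)
    (fun x hx => h.sq_add_sq_pos hp hr hq hx₁ hne hx)
  refine ⟨R, θ, hpol, fun x hx => ?_, fun x hx => ?_⟩
  · refine (hR x hx).congr_deriv ?_
    obtain ⟨h1, h2⟩ := hpol x hx
    have e : u x ^ 2 + v x ^ 2 = Real.exp (R x) ^ 2 := by
      rw [h1, h2]
      linear_combination Real.exp (R x) ^ 2 * Real.sin_sq_add_cos_sq (θ x)
    simp only [Pi.mul_apply, Pi.add_apply, Pi.sub_apply]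
    rw [e, h1, h2, radialForm, div_eq_iff (by positivity)]
    ring
  · refine (hθ x hx).congr_deriv ?_
    obtain ⟨h1, h2⟩ := hpol x hx
    have e : u x ^ 2 + v x ^ 2 = Real.exp (R x) ^ 2 := by
      rw [h1, h2]
      linear_combination Real.exp (R x) ^ 2 * Real.sin_sq_add_cos_sq (θ x)
    simp only [Pi.mul_apply, Pi.add_apply, Pi.sub_apply]
    rw [e, h1, h2, circleForm, div_eq_iff (by positivity)]
    ring

/-! ### Quadratic forms on the circle -/

theorem circleForm_add_int_mul_pi (a b d θ : ℝ) (n : ℤ) :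
    circleForm a b d (θ + n * Real.pi) = circleForm a b d θ := by
  have h : ((-1 : ℝ) ^ n) ^ 2 = 1 := by
    rcases Int.even_or_odd n with hn | hn
    · simp [hn.neg_one_zpow]
    · simp [hn.neg_one_zpow]
  simp only [circleForm, Real.cos_add_int_mul_pi, Real.sin_add_int_mul_pi]
  linear_combination (a * Real.cos θ ^ 2 + 2 * b * (Real.cos θ * Real.sin θ) +
    d * Real.sin θ ^ 2) * h

theorem circleForm_neg (a b d θ : ℝ) : circleForm (-a) b (-d) (-θ) = -circleForm a b d θ := by
  simp only [circleForm, Real.cos_neg, Real.sin_neg]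
  ring

theorem hasDerivAt_circleForm (a b d θ : ℝ) :
    HasDerivAt (circleForm a b d) (-2 * radialForm a b d θ) θ := by
  have hc := Real.hasDerivAt_cos θ
  have hs := Real.hasDerivAt_sin θ
  refine ((((hc.pow 2).const_mul a).add ((hc.mul hs).const_mul (2 * b))).add
    ((hs.pow 2).const_mul d)).congr_deriv ?_
  simp only [radialForm]
  push_cast
  ring

/-- For the symmetric matrix `S` of the form and the unit vector `e` at angle `θ`, the two forms are
`⟨Se, e⟩` and `-⟨Se, e^⊥⟩`. Their squares add up to `|Se|²`, which is `tr S ⟨Se, e⟩ - det S` by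
Cayley–Hamilton. In particular the radial form equals `±√(-det S)` at a null direction. -/
theorem radialForm_sq (a b d θ : ℝ) : radialForm a b d θ ^ 2 =
    b ^ 2 - a * d - circleForm a b d θ ^ 2 + (a + d) * circleForm a b d θ := by
  have h : Real.sin θ ^ 2 = 1 - Real.cos θ ^ 2 := by
    linarith [Real.sin_sq_add_cos_sq θ]
  simp only [radialForm, circleForm]
  ring_nf
  have h3 : Real.sin θ ^ 3 = Real.sin θ * (1 - Real.cos θ ^ 2) := by rw [← h]; ring
  have h4 : Real.sin θ ^ 4 = (1 - Real.cos θ ^ 2) ^ 2 := by rw [← h]; ring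
  rw [h3, h4, h]
  ring

theorem tendsto_circleForm {ι : Type*} {l : Filter ι} {A B D θ : ι → ℝ} {a b d L : ℝ}
    (hA : Tendsto A l (𝓝 a)) (hB : Tendsto B l (𝓝 b)) (hD : Tendsto D l (𝓝 d))
    (hθ : Tendsto θ l (𝓝 L)) :
    Tendsto (fun t => circleForm (A t) (B t) (D t) (θ t)) l (𝓝 (circleForm a b d L)) := by
  have hc : Tendsto (fun t => Real.cos (θ t)) l (𝓝 (Real.cos L)) :=
    (Real.continuous_cos.tendsto L).comp hθ
  have hs : Tendsto (fun t => Real.sin (θ t)) l (𝓝 (Real.sin L)) :=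
    (Real.continuous_sin.tendsto L).comp hθ
  exact ((hA.mul (hc.pow 2)).add ((hB.const_mul 2).mul (hc.mul hs))).add (hD.mul (hs.pow 2))

theorem tendsto_radialForm {ι : Type*} {l : Filter ι} {A B D θ : ι → ℝ} {a b d L : ℝ}
    (hA : Tendsto A l (𝓝 a)) (hB : Tendsto B l (𝓝 b)) (hD : Tendsto D l (𝓝 d))
    (hθ : Tendsto θ l (𝓝 L)) :
    Tendsto (fun t => radialForm (A t) (B t) (D t) (θ t)) l (𝓝 (radialForm a b d L)) := by
  have hc : Tendsto (fun t => Real.cos (θ t)) l (𝓝 (Real.cos L)) :=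
    (Real.continuous_cos.tendsto L).comp hθ
  have hs : Tendsto (fun t => Real.sin (θ t)) l (𝓝 (Real.sin L)) :=
    (Real.continuous_sin.tendsto L).comp hθ
  exact (hB.neg.mul ((hc.pow 2).sub (hs.pow 2))).add ((hA.sub hD).mul (hc.mul hs))

/-- In the double angle the form is `(a + d) / 2 + ‖ζ‖ cos (2θ - arg ζ)`, with maximum at `θ = arg ζ
/ 2`. A negative determinant means `‖ζ‖ > |a + d| / 2`. -/
theorem exists_circleForm_pos {a b d : ℝ} (h : a * d - b ^ 2 < 0) :
    ∃ θ, 0 < circleForm a b d θ := by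
  set ζ : ℂ := ⟨(a - d) / 2, b⟩ with hζ
  have h1 : ‖ζ‖ * Real.cos ζ.arg = (a - d) / 2 := Complex.norm_mul_cos_arg ζ
  have h2 : ‖ζ‖ * Real.sin ζ.arg = b := Complex.norm_mul_sin_arg ζ
  have hn : ‖ζ‖ ^ 2 = ((a - d) / 2) ^ 2 + b ^ 2 := by
    rw [← h1, ← h2]
    linear_combination -‖ζ‖ ^ 2 * Real.sin_sq_add_cos_sq ζ.arg
  refine ⟨ζ.arg / 2, ?_⟩
  have ha : ζ.arg = 2 * (ζ.arg / 2) := by ring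
  have hc : Real.cos ζ.arg = 2 * Real.cos (ζ.arg / 2) ^ 2 - 1 := by
    rw [← Real.cos_two_mul, ← ha]
  have hs : Real.sin ζ.arg = 2 * Real.sin (ζ.arg / 2) * Real.cos (ζ.arg / 2) := by
    rw [← Real.sin_two_mul, ← ha]
  have key : circleForm a b d (ζ.arg / 2) = (a + d) / 2 + ‖ζ‖ := by
    have e : ‖ζ‖ = (a - d) / 2 * Real.cos ζ.arg + b * Real.sin ζ.arg := by
      rw [← h1, ← h2]
      linear_combination -‖ζ‖ * Real.sin_sq_add_cos_sq ζ.arg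
    rw [e, hc, hs, circleForm]
    linear_combination d * Real.sin_sq_add_cos_sq (ζ.arg / 2)
  rw [key]
  by_contra! hcon
  nlinarith [norm_nonneg ζ]

/-! ### Convergence of angles -/

theorem exists_linear_lower_bound {f f' : ℝ → ℝ} {m : ℝ}
    (hd : ∀ᶠ t in atTop, HasDerivAt f (f' t) t) (hm : ∀ᶠ t in atTop, m ≤ f' t) :
    ∃ C : ℝ, ∀ᶠ t in atTop, C + m * t ≤ f t := by
  obtain ⟨T, hT⟩ := eventually_atTop.mp (hd.and hm)
  have hder : ∀ t, T ≤ t → HasDerivAt (fun t => f t - m * t) (f' t - m) t := by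
    intro t ht
    exact ((hT t ht).1.sub ((hasDerivAt_id t).const_mul m)).congr_deriv (by ring)
  have hmono : MonotoneOn (fun t => f t - m * t) (Ici T) := by
    refine monotoneOn_of_deriv_nonneg (convex_Ici T)
      (fun t ht => (hder t ht).continuousAt.continuousWithinAt)
      (fun t ht => (hder t (interior_subset ht)).differentiableAt.differentiableWithinAt) ?_
    intro t ht
    rw [(hder t (interior_subset ht)).deriv]
    linarith [(hT t (interior_subset ht)).2]
  refine ⟨f T - m * T, ?_⟩
  filter_upwards [eventually_ge_atTop T] with t ht
  have := hmono (mem_Ici.mpr le_rfl) (mem_Ici.mpr ht) ht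
  simp only at this
  linarith

/-- The equation `θ' = g (A cos² θ + 2 B cos θ sin θ + D sin² θ)` near `+∞`, with `g ≥ 1` and
coefficients `A`, `B`, `D` that converge to those of an indefinite form. -/
structure IsAngularFlow (g A B D θ : ℝ → ℝ) (a b d : ℝ) : Prop where
  det_neg : a * d - b ^ 2 < 0
  tendsto_A : Tendsto A atTop (𝓝 a)
  tendsto_B : Tendsto B atTop (𝓝 b)
  tendsto_D : Tendsto D atTop (𝓝 d)
  one_le : ∀ᶠ t in atTop, 1 ≤ g t
  hasDerivAt : ∀ᶠ t in atTop, HasDerivAt θ (g t * circleForm (A t) (B t) (D t) (θ t)) t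

namespace IsAngularFlow

variable {g A B D θ : ℝ → ℝ} {a b d : ℝ}

/-- The reflection `θ ↦ -θ` turns each one-sided estimate below into its mirror image. -/
theorem neg (h : IsAngularFlow g A B D θ a b d) :
    IsAngularFlow g (fun t => -A t) B (fun t => -D t) (fun t => -θ t) (-a) b (-d) where
  det_neg := by linarith [h.det_neg]
  tendsto_A := h.tendsto_A.neg
  tendsto_B := h.tendsto_B
  tendsto_D := h.tendsto_D.neg
  one_le := h.one_le
  hasDerivAt := by
    filter_upwards [h.hasDerivAt] with t ht
    refine ht.neg.congr_deriv ?_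
    rw [circleForm_neg]
    ring

/-- For large `t` the vector field points upwards at the level `c`, and by `π`-periodicity of the
form at all levels `c + nπ`, with one `T` for every `n`. The angle cannot cross such a level
downwards. -/
theorem barrier (h : IsAngularFlow g A B D θ a b d) {c : ℝ} (hc : 0 < circleForm a b d c) :
    ∃ T : ℝ, ∀ (n : ℤ) (s t : ℝ), T ≤ s → s ≤ t → c + n * Real.pi ≤ θ s →
      c + n * Real.pi ≤ θ t := by
  have hlim := tendsto_circleForm h.tendsto_A h.tendsto_B h.tendsto_D
    (tendsto_const_nhds (x := c))
  obtain ⟨T, hT⟩ := eventually_atTop.mp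
    (((hlim.eventually_const_lt hc).and h.one_le).and h.hasDerivAt)
  refine ⟨T, fun n s t hs hst hle => ?_⟩
  have hd : ∀ x ∈ Icc s t, HasDerivAt (fun x => -θ x) _ x := fun x hx =>
    (hT x (hs.trans hx.1)).2.neg
  have := image_le_of_deriv_right_lt_deriv_boundary' (f := fun x => -θ x)
    (B := fun _ => -(c + n * Real.pi)) (B' := fun _ => 0)
    (fun x hx => (hd x hx).continuousAt.continuousWithinAt)
    (fun x hx => (hd x (Ico_subset_Icc_self hx)).hasDerivWithinAt)
    (neg_le_neg hle) continuousOn_const (fun x _ => (hasDerivAt_const x _).hasDerivWithinAt)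
    (fun x hx hxe => ?_) (right_mem_Icc.mpr hst)
  · exact neg_le_neg_iff.mp this
  · have hθ : θ x = c + n * Real.pi := neg_injective hxe
    rw [hθ, circleForm_add_int_mul_pi]
    obtain ⟨⟨h1, h2⟩, -⟩ := hT x (hs.trans hx.1)
    have : 0 < g x * circleForm (A x) (B x) (D x) c := mul_pos (by linarith) h1
    linarith

theorem isBoundedUnder_ge (h : IsAngularFlow g A B D θ a b d) :
    ∃ m, ∀ᶠ t in atTop, m ≤ θ t := by
  obtain ⟨c, hc⟩ := exists_circleForm_pos h.det_neg
  obtain ⟨T, hT⟩ := h.barrier hc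
  -- This is the highest level `c + nπ` not above `θ T`.
  refine ⟨c + (⌊(θ T - c) / Real.pi⌋ : ℤ) * Real.pi, ?_⟩
  filter_upwards [eventually_ge_atTop T] with t ht
  refine hT _ T t le_rfl ht ?_
  have := Int.floor_le ((θ T - c) / Real.pi)
  rw [le_div_iff₀ Real.pi_pos] at this
  linarith

theorem not_frequently (h : IsAngularFlow g A B D θ a b d) {c : ℝ}
    (hc : 0 < circleForm a b d c) :
    ¬((∃ᶠ t in atTop, θ t < c) ∧ ∃ᶠ t in atTop, c ≤ θ t) := by
  rintro ⟨h1, h2⟩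
  obtain ⟨T, hT⟩ := h.barrier hc
  obtain ⟨s, hs, hsT⟩ := (h2.and_eventually (eventually_ge_atTop T)).exists
  obtain ⟨t, ht, hts⟩ := (h1.and_eventually (eventually_ge_atTop s)).exists
  have := hT 0 s t hsT hts (by simpa using hs)
  simp only [Int.cast_zero, zero_mul, add_zero] at this
  linarith

/-- Otherwise `θ'` would eventually exceed a positive constant, since `g ≥ 1`, and `θ` would be
unbounded. -/
theorem circleForm_limit_nonpos (h : IsAngularFlow g A B D θ a b d) {L : ℝ}
    (hL : Tendsto θ atTop (𝓝 L)) : circleForm a b d L ≤ 0 := by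
  by_contra! hpos
  have hlim := tendsto_circleForm h.tendsto_A h.tendsto_B h.tendsto_D hL
  obtain ⟨C, hC⟩ := exists_linear_lower_bound (m := circleForm a b d L / 2) h.hasDerivAt (by
    filter_upwards [hlim.eventually_const_lt (half_lt_self hpos), h.one_le] with t h1 h2
    nlinarith)
  have htop : Tendsto (fun t => C + circleForm a b d L / 2 * t) atTop atTop :=
    tendsto_atTop_add_const_left _ _ (tendsto_id.const_mul_atTop (half_pos hpos))
  exact not_tendsto_nhds_of_tendsto_atTop (tendsto_atTop_mono' _ hC htop) L hL

/-- The angle converges to a zero of the limiting form. -/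
theorem exists_tendsto (h : IsAngularFlow g A B D θ a b d) :
    ∃ L, Tendsto θ atTop (𝓝 L) ∧ circleForm a b d L = 0 := by
  -- The zeros of the form are isolated: there its derivative `-2 * radialForm` is nonzero, its
  -- square being `4 (b² - ad) > 0`.
  have hdense : Dense {c : ℝ | circleForm a b d c ≠ 0} := by
    intro c
    by_cases hc : circleForm a b d c = 0
    · have hne : -2 * radialForm a b d c ≠ 0 := by
        intro h0
        have h1 := radialForm_sq a b d c
        have h2 : radialForm a b d c = 0 := by linarith
        rw [h2, hc] at h1
        linarith [h.det_neg]
      have hev := (hasDerivAt_circleForm a b d c).eventually_ne (c := 0) hne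
      exact mem_closure_iff_frequently.mpr (hev.frequently.filter_mono nhdsWithin_le_nhds)
    · exact subset_closure hc
  obtain ⟨m, hm⟩ := h.isBoundedUnder_ge
  obtain ⟨m', hm'⟩ := h.neg.isBoundedUnder_ge
  -- No level of the dense set is crossed infinitely often: barriers stop downward crossings where
  -- the form is positive, and by reflection upward ones where it is negative.
  obtain ⟨L, hL⟩ := tendsto_of_no_upcrossings (u := θ) hdense (f := atTop) (by
      rintro c hc c' - hcc' ⟨h1, h2⟩
      rcases lt_or_gt_of_ne hc with hneg | hpos
      · have hpos : 0 < circleForm (-a) b (-d) (-c) := by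
          rw [circleForm_neg]
          linarith
        refine h.neg.not_frequently hpos ⟨h2.mono fun t ht => ?_, h1.mono fun t ht => ?_⟩
        · linarith
        · linarith
      · exact h.not_frequently hpos ⟨h1, h2.mono fun t ht => by linarith⟩)
    ⟨-m', eventually_map.mpr (hm'.mono fun t ht => by linarith)⟩
    ⟨m, eventually_map.mpr hm⟩
  refine ⟨L, hL, le_antisymm (h.circleForm_limit_nonpos hL) ?_⟩
  have := h.neg.circleForm_limit_nonpos hL.neg
  rw [circleForm_neg] at this
  linarith

end IsAngularFlow

/-! ### Behaviour of solutions at zero and at infinity -/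

theorem tendsto_exp_neg_nhdsGT : Tendsto (fun t : ℝ => Real.exp (-t)) atTop (𝓝[>] 0) :=
  Real.tendsto_exp_atBot_nhdsGT.comp tendsto_neg_atTop_atBot

theorem tendsto_neg_log_nhdsGT : Tendsto (fun x : ℝ => -Real.log x) (𝓝[>] 0) atTop :=
  tendsto_neg_atBot_atTop.comp Real.tendsto_log_nhdsGT_zero

theorem tendsto_rpow_nhdsGT_zero {β : ℝ} (hβ : 0 < β) :
    Tendsto (fun x : ℝ => x ^ β) (𝓝[>] 0) (𝓝 0) := by
  have h := (Real.continuousAt_rpow_const 0 β (Or.inr hβ.le)).tendsto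
  rw [Real.zero_rpow hβ.ne'] at h
  exact h.mono_left nhdsWithin_le_nhds

/-- The limiting form `diag(λ - μ⁻, λ - μ⁺)` is indefinite because `λ` lies strictly inside the gap.
-/
theorem exists_tendsto_angle_atTop {p r q θ : ℝ → ℝ} {lam μm μp : ℝ} (hlam : lam ∈ Ioo μm μp)
    (hp : Tendsto p atTop (𝓝 μm)) (hr : Tendsto r atTop (𝓝 0)) (hq : Tendsto q atTop (𝓝 μp))
    (hθ : ∀ x, 0 < x →
      HasDerivAt θ (circleForm (lam - p x) (-r x) (lam - q x) (θ x)) x) :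
    ∃ L, Tendsto θ atTop (𝓝 L) := by
  have hflow : IsAngularFlow (fun _ => 1) (fun x => lam - p x) (fun x => -r x)
      (fun x => lam - q x) θ (lam - μm) (-0) (lam - μp) :=
    { det_neg := by nlinarith [mul_pos (sub_pos.mpr hlam.1) (sub_pos.mpr hlam.2)]
      tendsto_A := hp.const_sub lam
      tendsto_B := hr.neg
      tendsto_D := hq.const_sub lam
      one_le := Eventually.of_forall fun _ => le_rfl
      hasDerivAt := by
        filter_upwards [eventually_gt_atTop 0] with x hx
        simpa using hθ x hx }
  obtain ⟨L, hL, -⟩ := hflow.exists_tendsto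
  exact ⟨L, hL⟩

/-- Near the singular endpoint `0` the angle converges to a null direction of the limiting form,
and the solution either tends to `0` or is at least of the size of `x ^ (-1/2)`. -/
theorem exists_tendsto_angle_zero {p r q R θ : ℝ → ℝ} {lam β a b d : ℝ} (hβ : 1 ≤ β)
    (hp : Tendsto (fun x => x ^ β * p x) (𝓝[>] 0) (𝓝 a))
    (hr : Tendsto (fun x => x ^ β * r x) (𝓝[>] 0) (𝓝 b))
    (hq : Tendsto (fun x => x ^ β * q x) (𝓝[>] 0) (𝓝 d))
    (hdet : a * d - b ^ 2 < 0) (hdet1 : β = 1 → a * d - b ^ 2 < -1 / 4)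
    (hR : ∀ x, 0 < x →
      HasDerivAt R (radialForm (lam - p x) (-r x) (lam - q x) (θ x)) x)
    (hθ : ∀ x, 0 < x →
      HasDerivAt θ (circleForm (lam - p x) (-r x) (lam - q x) (θ x)) x) :
    ∃ L, Tendsto θ (𝓝[>] 0) (𝓝 L) ∧ circleForm a b d L = 0 ∧
      ((radialForm a b d L < 0 ∧ Tendsto R (𝓝[>] 0) atBot) ∨
        ∃ C, ∀ᶠ x in 𝓝[>] 0, C - Real.log x ≤ 2 * R x) := by
  -- The substitution `x = y t = exp (-t)` moves the endpoint `0` to `+∞`. Since `dx/dt = -x = -g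
  -- x^β`, the rescaled coefficients `x^β (P - λ)` appear with the factor `g`, and the minus sign
  -- turns `λ - P` into `P - λ`. As `β ≥ 1`, `g ≥ 1` for `t ≥ 0`.
  set g : ℝ → ℝ := fun t => Real.exp ((β - 1) * t) with hg
  set y : ℝ → ℝ := fun t => Real.exp (-t) with hy
  have hyt : Tendsto y atTop (𝓝[>] 0) := tendsto_exp_neg_nhdsGT
  have hy0 : ∀ t, 0 < y t := fun t => Real.exp_pos _
  have hyd : ∀ t, HasDerivAt y (-y t) t := fun t =>
    ((hasDerivAt_neg t).exp).congr_deriv (by simp [hy])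
  have hgy : ∀ t, g t * y t ^ β = y t := by
    intro t
    simp only [hg, hy]
    rw [← Real.exp_mul, ← Real.exp_add]
    congr 1
    ring
  have hlim0 := (tendsto_rpow_nhdsGT_zero (β := β) (by linarith)).mul_const lam
  rw [zero_mul] at hlim0
  have hA := (hp.sub hlim0).comp hyt
  have hB := hr.comp hyt
  have hD := (hq.sub hlim0).comp hyt
  rw [sub_zero] at hA hD
  set A : ℝ → ℝ := fun t => y t ^ β * p (y t) - y t ^ β * lam
  set B : ℝ → ℝ := fun t => y t ^ β * r (y t)
  set D : ℝ → ℝ := fun t => y t ^ β * q (y t) - y t ^ β * lam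
  have hg1 : ∀ t, 0 ≤ t → 1 ≤ g t := fun t ht =>
    Real.one_le_exp (mul_nonneg (by linarith) ht)
  have hθd : ∀ t, HasDerivAt (fun t => θ (y t))
      (g t * circleForm (A t) (B t) (D t) (θ (y t))) t := by
    intro t
    refine ((hθ (y t) (hy0 t)).comp t (hyd t)).congr_deriv ?_
    have e : circleForm (A t) (B t) (D t) (θ (y t)) = -(y t ^ β) *
        circleForm (lam - p (y t)) (-r (y t)) (lam - q (y t)) (θ (y t)) := by
      simp only [circleForm, A, B, D]
      ring
    rw [e]
    linear_combination circleForm (lam - p (y t)) (-r (y t)) (lam - q (y t)) (θ (y t)) * hgy t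
  have hRd : ∀ t, HasDerivAt (fun t => R (y t))
      (g t * radialForm (A t) (B t) (D t) (θ (y t))) t := by
    intro t
    refine ((hR (y t) (hy0 t)).comp t (hyd t)).congr_deriv ?_
    have e : radialForm (A t) (B t) (D t) (θ (y t)) = -(y t ^ β) *
        radialForm (lam - p (y t)) (-r (y t)) (lam - q (y t)) (θ (y t)) := by
      simp only [radialForm, A, B, D]
      ring
    rw [e]
    linear_combination radialForm (lam - p (y t)) (-r (y t)) (lam - q (y t)) (θ (y t)) * hgy t
  have hflow : IsAngularFlow g A B D (fun t => θ (y t)) a b d :=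
    { det_neg := hdet
      tendsto_A := hA
      tendsto_B := hB
      tendsto_D := hD
      one_le := (eventually_ge_atTop 0).mono hg1
      hasDerivAt := Eventually.of_forall hθd }
  obtain ⟨L, hL, hL0⟩ := hflow.exists_tendsto
  have hback : ∀ x ∈ Ioi (0 : ℝ), y (-Real.log x) = x := by
    intro x hx
    simp only [hy, neg_neg]
    exact Real.exp_log hx
  have hκ : Tendsto (fun t => radialForm (A t) (B t) (D t) (θ (y t))) atTop
      (𝓝 (radialForm a b d L)) := tendsto_radialForm hA hB hD hL
  have hsq := radialForm_sq a b d L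
  rw [hL0] at hsq
  set κ := radialForm a b d L with hκdef
  refine ⟨L, ?_, hL0, ?_⟩
  · refine (hL.comp tendsto_neg_log_nhdsGT).congr' ?_
    filter_upwards [self_mem_nhdsWithin] with x hx
    simp only [Function.comp_apply, hback x hx]
  have hκ0 : κ ≠ 0 := by
    intro h0
    rw [h0] at hsq
    linarith
  rcases lt_or_gt_of_ne hκ0 with hneg | hpos
  · refine Or.inl ⟨hneg, ?_⟩
    obtain ⟨C, hC⟩ := exists_linear_lower_bound (f := fun t => -R (y t)) (m := -κ / 2)
      (Eventually.of_forall fun t => (hRd t).neg) (by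
        filter_upwards [hκ.eventually_lt_const (by linarith : κ < κ / 2),
          eventually_ge_atTop 0] with t h1 h2
        nlinarith [hg1 t h2])
    have htop : Tendsto (fun t => -R (y t)) atTop atTop :=
      tendsto_atTop_mono' _ hC
        (tendsto_atTop_add_const_left _ _ (tendsto_id.const_mul_atTop (by linarith)))
    have hbot : Tendsto (fun t => R (y t)) atTop atBot := tendsto_neg_atTop_iff.mp htop
    refine (hbot.comp tendsto_neg_log_nhdsGT).congr' ?_
    filter_upwards [self_mem_nhdsWithin] with x hx
    simp only [Function.comp_apply, hback x hx]
  · refine Or.inr ?_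
    -- Radial growth at rate `1 / 2` in `t` means `exp (2R) ≥ c exp t = c / x`. For `β = 1` one has
    -- `g = 1`, and `κ² = -det > 1/4` supplies the rate; for `β > 1` any `κ > 0` suffices because
    -- `g` tends to infinity.
    have hhalf : ∀ᶠ t in atTop, 1 / 2 ≤ g t * radialForm (A t) (B t) (D t) (θ (y t)) := by
      rcases hβ.eq_or_lt with h1 | h1
      · have hκ2 : 1 / 2 < κ := by
          have := hdet1 h1.symm
          nlinarith
        filter_upwards [hκ.eventually_const_lt hκ2] with t ht
        simp only [hg, ← h1, sub_self, zero_mul, Real.exp_zero, one_mul]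
        exact ht.le
      · have hgt : Tendsto g atTop atTop :=
          Real.tendsto_exp_atTop.comp (tendsto_id.const_mul_atTop (by linarith))
        exact (hgt.atTop_mul_pos hpos hκ).eventually_ge_atTop _
    obtain ⟨C, hC⟩ := exists_linear_lower_bound (Eventually.of_forall hRd) hhalf
    refine ⟨2 * C, ?_⟩
    filter_upwards [tendsto_neg_log_nhdsGT.eventually hC, self_mem_nhdsWithin] with x h1 h2
    rw [hback x h2] at h1
    linarith

/-- The hypothesis bounds `|z|²` below by `exp C / x` near zero, and `1 / x` is not integrable
there. -/
theorem not_memLp_two_of_inv_le {z : ℝ → Fin 2 → ℝ} {R : ℝ → ℝ} {C : ℝ}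
    (hz : ∀ x, 0 < x → z x 0 ^ 2 + z x 1 ^ 2 = Real.exp (2 * R x))
    (hR : ∀ᶠ x in 𝓝[>] 0, C - Real.log x ≤ 2 * R x) :
    ¬MemLp z 2 (volume.restrict (Ioi (0 : ℝ))) := by
  intro hmem
  obtain ⟨δ, hδ, hδR⟩ := mem_nhdsGT_iff_exists_Ioc_subset.mp hR
  have hδ0 : (0 : ℝ) < δ := hδ
  have hint : IntegrableOn (fun x => ‖z x‖ ^ 2) (Ioi 0) :=
    (memLp_two_iff_integrable_sq_norm hmem.1).mp hmem
  have hint2 : IntegrableOn (fun x : ℝ => x⁻¹) (Ioc 0 δ) := by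
    refine Integrable.mono' ((hint.mono_set Ioc_subset_Ioi_self).const_mul (2 * Real.exp (-C)))
      measurable_inv.aestronglyMeasurable ?_
    filter_upwards [ae_restrict_mem measurableSet_Ioc] with x hx
    have hx0 : 0 < x := hx.1
    have h1 : C - Real.log x ≤ 2 * R x := hδR hx
    have h2 : Real.exp C * x⁻¹ ≤ z x 0 ^ 2 + z x 1 ^ 2 := by
      rw [hz x hx0, ← Real.exp_log (inv_pos.mpr hx0), ← Real.exp_add, Real.log_inv]
      exact Real.exp_le_exp.mpr (by linarith)
    have h3 : ∀ i, z x i ^ 2 ≤ ‖z x‖ ^ 2 := fun i =>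
      sq_le_sq' (by linarith [(abs_le.mp (norm_le_pi_norm (z x) i)).1])
        (abs_le.mp (norm_le_pi_norm (z x) i)).2
    have h4 : Real.exp C * x⁻¹ ≤ 2 * ‖z x‖ ^ 2 := by linarith [h3 0, h3 1]
    have h5 : Real.exp (-C) * Real.exp C = 1 := by
      rw [← Real.exp_add, neg_add_cancel, Real.exp_zero]
    rw [Real.norm_of_nonneg (inv_pos.mpr hx0).le]
    calc x⁻¹ = Real.exp (-C) * (Real.exp C * x⁻¹) := by rw [← mul_assoc, h5, one_mul]
      _ ≤ Real.exp (-C) * (2 * ‖z x‖ ^ 2) :=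
        mul_le_mul_of_nonneg_left h4 (Real.exp_pos _).le
      _ = 2 * Real.exp (-C) * ‖z x‖ ^ 2 := by ring
  have := (intervalIntegrable_iff_integrableOn_Ioc_of_le hδ0.le).mpr hint2
  rcases intervalIntegrable_inv_iff.mp this with h | h
  · exact hδ0.ne h
  · exact h left_mem_uIcc

/-- The null direction with negative radial rate is the eigendirection of `J⁻¹ P*` for its
negative eigenvalue. -/
theorem sin_sub_eq_zero_of_eigenvector {a b d L κ ρ α : ℝ} (hρ : ρ ≠ 0)
    (hL : circleForm a b d L = 0) (hκ : radialForm a b d L = κ) (hκ0 : κ ≠ 0)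
    (h0 : -(b * (ρ * Real.cos α) + d * (ρ * Real.sin α)) = κ * (ρ * Real.cos α))
    (h1 : a * (ρ * Real.cos α) + b * (ρ * Real.sin α) = κ * (ρ * Real.sin α)) :
    Real.sin (L - α) = 0 := by
  have e := Real.sin_sq_add_cos_sq L
  simp only [circleForm] at hL
  simp only [radialForm] at hκ
  -- `k0` and `k1` say that `(cos L, sin L)` is an eigenvector of `J⁻¹ S` for `κ`, `S` being the
  -- matrix of the form.
  have k0 : -(b * Real.cos L + d * Real.sin L) = κ * Real.cos L := by
    linear_combination Real.cos L * hκ - Real.sin L * hL +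
      (b * Real.cos L + d * Real.sin L) * e
  have k1 : a * Real.cos L + b * Real.sin L = κ * Real.sin L := by
    linear_combination Real.sin L * hκ + Real.cos L * hL -
      (a * Real.cos L + b * Real.sin L) * e
  -- `M = J⁻¹ S` is trace free, so the area form satisfies `ω(Mx, y) + ω(x, My) = 0`. For two
  -- eigenvectors with eigenvalue `κ` this gives `2κ ω(x, y) = 0`, so they are parallel.
  have key : (2 * κ * ρ) * Real.sin (L - α) = 0 := by
    rw [Real.sin_sub]
    linear_combination Real.cos L * h1 - Real.sin L * h0 +
      (ρ * Real.sin α) * k0 - (ρ * Real.cos α) * k1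
  exact (mul_eq_zero.mp key).resolve_left (mul_ne_zero (mul_ne_zero two_ne_zero hκ0) hρ)

/-! ### Uniqueness of the recessive solution -/

theorem exists_int_of_sin_eq_zero {φ : ℝ → ℝ} (hφ : ContinuousOn φ (Ioi 0))
    (h : ∀ x, 0 < x → Real.sin (φ x) = 0) : ∃ n : ℤ, ∀ x, 0 < x → φ x = n * Real.pi := by
  have hsub : (φ '' Ioi 0).Subsingleton := by
    have hcount : (φ '' Ioi 0).Countable := by
      refine (countable_range fun n : ℤ => (n : ℝ) * Real.pi).mono ?_
      rintro _ ⟨x, hx, rfl⟩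
      exact Real.sin_eq_zero_iff.mp (h x hx)
    exact hcount.isTotallyDisconnected _ subset_rfl (isPreconnected_Ioi.image _ hφ)
  obtain ⟨n, hn⟩ := Real.sin_eq_zero_iff.mp (h 1 one_pos)
  refine ⟨n, fun x hx => ?_⟩
  rw [hn]
  exact hsub ⟨x, hx, rfl⟩ ⟨1, mem_Ioi.mpr one_pos, rfl⟩

theorem IsClassicalSolution.wronskian_eq {p r q : ℝ → ℝ} {lam : ℝ} {u v u' v' : ℝ → ℝ}
    (h : IsClassicalSolution p r q lam u v) (h' : IsClassicalSolution p r q lam u' v')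
    {x : ℝ} (hx : 0 < x) : u x * v' x - v x * u' x = u 1 * v' 1 - v 1 * u' 1 := by
  have hd : ∀ y, 0 < y → HasDerivAt (fun y => u y * v' y - v y * u' y) 0 y := by
    intro y hy
    refine (((h y hy).1.mul (h' y hy).2).sub ((h y hy).2.mul (h' y hy).1)).congr_deriv ?_
    ring
  exact isOpen_Ioi.is_const_of_deriv_eq_zero isPreconnected_Ioi
    (fun y hy => (hd y hy).differentiableAt.differentiableWithinAt)
    (fun y hy => (hd y hy).deriv) (mem_Ioi.mpr hx) (mem_Ioi.mpr one_pos)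

theorem tendsto_apply_zero {z : ℝ → Fin 2 → ℝ} {l : Filter ℝ} (hz : Tendsto z l (𝓝 0))
    (i : Fin 2) : Tendsto (fun x => z x i) l (𝓝 0) :=
  tendsto_pi_nhds.mp hz i

/-- The Wronskian of two recessive solutions is constant and tends to `0` at zero, so it vanishes
and the angles differ by a constant `nπ`. Both initial angles lie in `[0, π)`, hence `n = 0`. -/
theorem HasNu.unique {P : ℝ → Matrix (Fin 2) (Fin 2) ℝ} {lam c c' : ℝ}
    (hP : ContinuousOn P (Ioi 0)) (hsymm : ∀ x, 0 < x → (P x).IsSymm)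
    (h : HasNu P lam c) (h' : HasNu P lam c') : c = c' := by
  obtain ⟨ζ, θ, a, ⟨hsol, -, hζ0⟩, ⟨hθc, hpol⟩, hθ0, ha, hθ1⟩ := h
  obtain ⟨ζ', θ', a', ⟨hsol', -, hζ0'⟩, ⟨hθc', hpol'⟩, hθ0', ha', hθ1'⟩ := h'
  have hW : ∀ x, 0 < x → ζ x 0 * ζ' x 1 - ζ x 1 * ζ' x 0 =
      ζ 1 0 * ζ' 1 1 - ζ 1 1 * ζ' 1 0 := fun x hx =>
    (hsol.isClassicalSolution hP hsymm).wronskian_eq (hsol'.isClassicalSolution hP hsymm) hx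
  have hW0 : ζ 1 0 * ζ' 1 1 - ζ 1 1 * ζ' 1 0 = 0 := by
    have hlim := ((tendsto_apply_zero hζ0 0).mul (tendsto_apply_zero hζ0' 1)).sub
      ((tendsto_apply_zero hζ0 1).mul (tendsto_apply_zero hζ0' 0))
    rw [mul_zero, sub_zero] at hlim
    refine tendsto_nhds_unique (tendsto_const_nhds.congr' ?_) hlim
    filter_upwards [self_mem_nhdsWithin] with x hx using (hW x hx).symm
  obtain ⟨n, hn⟩ := exists_int_of_sin_eq_zero (hθc'.sub hθc) (by
    intro x hx
    obtain ⟨ρ, hρ, h0, h1⟩ := hpol x hx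
    obtain ⟨ρ', hρ', h0', h1'⟩ := hpol' x hx
    have hw := (hW x hx).trans hW0
    rw [h0, h1, h0', h1'] at hw
    have hw' : (ρ * ρ') * Real.sin (θ' x - θ x) = 0 := by
      rw [Real.sin_sub]
      linear_combination hw
    exact (mul_eq_zero.mp hw').resolve_left (mul_pos hρ hρ').ne')
  have hn' : ∀ x, 0 < x → θ' x - θ x = n * Real.pi := hn
  have e0 : a' - a = n * Real.pi := by
    refine tendsto_nhds_unique (hθ0'.sub hθ0) (tendsto_const_nhds.congr' ?_)
    filter_upwards [self_mem_nhdsWithin] with x hx using (hn' x hx).symm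
  have e1 : c' - c = n * Real.pi := by
    refine tendsto_nhds_unique (hθ1'.sub hθ1) (tendsto_const_nhds.congr' ?_)
    filter_upwards [eventually_gt_atTop 0] with x hx using (hn' x hx).symm
  have hpi := Real.pi_pos
  have hn0 : n = 0 := by
    have h1 : (n : ℝ) < 1 := by
      have : (n : ℝ) * Real.pi < 1 * Real.pi := by linarith [ha.1, ha'.2]
      exact lt_of_mul_lt_mul_right this hpi.le
    have h2 : (-1 : ℝ) < n := by
      have : (-1 : ℝ) * Real.pi < n * Real.pi := by linarith [ha.2, ha'.1]
      exact lt_of_mul_lt_mul_right this hpi.le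
    have h1' : n < 1 := by exact_mod_cast h1
    have h2' : -1 < n := by exact_mod_cast h2
    omega
  rw [hn0, Int.cast_zero, zero_mul] at e1
  linarith

/-! ### Sign changes and shifts of the angle -/

theorem IsRecessiveAtZero.neg {P : ℝ → Matrix (Fin 2) (Fin 2) ℝ} {lam : ℝ}
    {z : ℝ → Fin 2 → ℝ} (h : IsRecessiveAtZero P lam z) :
    IsRecessiveAtZero P lam fun x => -z x := by
  obtain ⟨⟨hac, hτ⟩, ⟨x, hx, hne⟩, h0⟩ := h
  refine ⟨⟨fun a b ha hab => (hac a b ha hab).neg, ?_⟩, ⟨x, hx, neg_ne_zero.mpr hne⟩, ?_⟩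
  · filter_upwards [hτ] with x hx
    have : tau P (fun x => -z x) x = -tau P z x := by
      simp only [tau, deriv.fun_neg, Matrix.mulVec_neg]
      abel
    rw [this, hx, smul_neg]
  · simpa using h0.neg

/-- Normalizing the initial angle may require a shift by an odd multiple of `π`, which replaces the
solution by its negative. -/
theorem IsAngularCoordinate.exists_sign {z : ℝ → Fin 2 → ℝ} {θ : ℝ → ℝ}
    (h : IsAngularCoordinate z θ) (n : ℤ) :
    IsAngularCoordinate z (fun x => θ x - n * Real.pi) ∨
      IsAngularCoordinate (fun x => -z x) (fun x => θ x - n * Real.pi) := by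
  have hc : ContinuousOn (fun x => θ x - n * Real.pi) (Ioi 0) := h.1.sub continuousOn_const
  rcases Int.even_or_odd n with hn | hn
  · refine Or.inl ⟨hc, fun x hx => ?_⟩
    obtain ⟨ρ, hρ, h0, h1⟩ := h.2 x hx
    refine ⟨ρ, hρ, ?_, ?_⟩
    · rw [Real.cos_sub_int_mul_pi, hn.neg_one_zpow, one_mul, h0]
    · rw [Real.sin_sub_int_mul_pi, hn.neg_one_zpow, one_mul, h1]
  · refine Or.inr ⟨hc, fun x hx => ?_⟩
    obtain ⟨ρ, hρ, h0, h1⟩ := h.2 x hx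
    refine ⟨ρ, hρ, ?_, ?_⟩
    · change -z x 0 = _
      rw [Real.cos_sub_int_mul_pi, hn.neg_one_zpow, h0]
      ring
    · change -z x 1 = _
      rw [Real.sin_sub_int_mul_pi, hn.neg_one_zpow, h1]
      ring

/-! ### The rotation number of an eigenfunction -/

theorem inv_J : J⁻¹ = !![0, -1; 1, 0] := by
  refine Matrix.inv_eq_right_inv ?_
  ext i j
  fin_cases i <;> fin_cases j <;> simp [J]

/-- Removing the factor `1 / (β - 1)` lets the cases `β = 1` and `β > 1` be treated together. -/
theorem inv_J_mul_mulVec_eq {β : ℝ} {Pstar : Matrix (Fin 2) (Fin 2) ℝ} {w : Fin 2 → ℝ}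
    (hCw : Cmat β Pstar *ᵥ w = sigmaMinus β Pstar • w) :
    (J⁻¹ * Pstar) *ᵥ w = (-Real.sqrt (-Pstar.det)) • w := by
  rcases eq_or_ne β 1 with h | h
  · simpa [Cmat, sigmaMinus, h] using hCw
  · have h1 : β - 1 ≠ 0 := sub_ne_zero.mpr h
    simp only [Cmat, sigmaMinus, if_neg h, Matrix.smul_mulVec] at hCw
    have := congrArg (fun v => (β - 1) • v) hCw
    simp only [smul_smul] at this
    rwa [mul_one_div_cancel h1, one_smul, mul_div_cancel₀ _ h1] at this

/-- Square integrability at zero excludes the growing alternative. What remains is decay along a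
null direction of `P*` with negative radial rate, and this is the line spanned by `w`. -/
theorem exists_angle {μm μp : ℝ} {P : ℝ → Matrix (Fin 2) (Fin 2) ℝ} {β : ℝ}
    {Pstar : Matrix (Fin 2) (Fin 2) ℝ} (hP : ClassP μm μp P β Pstar)
    {w : Fin 2 → ℝ} (hCw : Cmat β Pstar *ᵥ w = sigmaMinus β Pstar • w)
    {α : ℝ} (hα : IsLineAngle w α) {lam : ℝ} (hlam : lam ∈ Ioo μm μp) {z : ℝ → Fin 2 → ℝ}
    (hz : IsEigenfunction P lam z) :
    IsRecessiveAtZero P lam z ∧ ∃ (θ : ℝ → ℝ) (n : ℤ) (b : ℝ), IsAngularCoordinate z θ ∧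
      Tendsto θ (𝓝[>] 0) (𝓝 (α + n * Real.pi)) ∧ Tendsto θ atTop (𝓝 b) := by
  obtain ⟨⟨hL2, hac, -⟩, hnt, hτ⟩ := hz
  have hsol : IsSolution P lam z := ⟨hac, hτ⟩
  have hPcont : ContinuousOn P (Ioi 0) := hP.continuousOn
  have hPc : ∀ i j, ContinuousOn (fun x => P x i j) (Ioi 0) := fun i j =>
    (continuous_apply_apply i j).comp_continuousOn hPcont
  have hP0 : ∀ i j, Tendsto (fun x : ℝ => x ^ β * P x i j) (𝓝[>] 0) (𝓝 (Pstar i j)) :=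
    fun i j => ((continuous_apply_apply i j).tendsto Pstar).comp hP.tendsto_zero
  have hP1 : ∀ i j, Tendsto (fun x : ℝ => P x i j) atTop (𝓝 (Pinf μm μp i j)) :=
    fun i j => ((continuous_apply_apply i j).tendsto (Pinf μm μp)).comp hP.tendsto_atTop
  have hsymm : Pstar 1 0 = Pstar 0 1 := hP.symm_star.apply 0 1
  have hdet : Pstar.det = Pstar 0 0 * Pstar 1 1 - Pstar 0 1 ^ 2 := by
    rw [Matrix.det_fin_two, hsymm]
    ring
  have hdetneg : Pstar.det < 0 := by
    rcases hP.one_le_beta.eq_or_lt with h | h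
    · linarith [hP.det_lt_of_eq h.symm]
    · exact hP.det_lt_of_gt h
  obtain ⟨x₁, hx₁, hne⟩ := id hnt
  have hne' : z x₁ 0 ≠ 0 ∨ z x₁ 1 ≠ 0 := by
    by_contra! hcon
    refine hne (funext fun i => ?_)
    fin_cases i
    · exact hcon.1
    · exact hcon.2
  obtain ⟨R, θ, hpol, hR, hθ⟩ := (hsol.isClassicalSolution hPcont hP.symm).exists_polar
    (hPc 0 0) (hPc 0 1) (hPc 1 1) hx₁ hne'
  obtain ⟨b, hb⟩ := exists_tendsto_angle_atTop hlam (by simpa [Pinf] using hP1 0 0)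
    (by simpa [Pinf] using hP1 0 1) (by simpa [Pinf] using hP1 1 1) hθ
  obtain ⟨L, hL, hL0, hcase⟩ := exists_tendsto_angle_zero hP.one_le_beta (hP0 0 0) (hP0 0 1)
    (hP0 1 1) (hdet ▸ hdetneg) (fun h => hdet ▸ hP.det_lt_of_eq h) hR hθ
  have hE : ∀ x, 0 < x → z x 0 ^ 2 + z x 1 ^ 2 = Real.exp (2 * R x) := by
    intro x hx
    obtain ⟨h0, h1⟩ := hpol x hx
    have e : Real.exp (2 * R x) = Real.exp (R x) ^ 2 := by
      rw [two_mul, Real.exp_add, sq]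
    rw [h0, h1, e]
    linear_combination Real.exp (R x) ^ 2 * Real.sin_sq_add_cos_sq (θ x)
  rcases hcase with ⟨hκneg, hRbot⟩ | ⟨C, hC⟩
  swap
  · exact absurd hL2 (not_memLp_two_of_inv_le hE hC)
  have hκ : radialForm (Pstar 0 0) (Pstar 0 1) (Pstar 1 1) L = -Real.sqrt (-Pstar.det) := by
    have hsq := radialForm_sq (Pstar 0 0) (Pstar 0 1) (Pstar 1 1) L
    rw [hL0] at hsq
    have : (-radialForm (Pstar 0 0) (Pstar 0 1) (Pstar 1 1) L) ^ 2 = -Pstar.det := by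
      rw [hdet]
      linarith
    -- The decaying alternative selects the negative square root.
    rw [← this, Real.sqrt_sq (by linarith), neg_neg]
  obtain ⟨-, ρ, hρ, hw0, hw1⟩ := hα
  have hMw := inv_J_mul_mulVec_eq hCw
  have m0 := congrFun hMw 0
  have m1 := congrFun hMw 1
  simp only [inv_J, Matrix.mulVec, dotProduct, Matrix.mul_apply, Fin.sum_univ_two,
    Matrix.of_apply, Matrix.cons_val', Matrix.cons_val_zero, Matrix.cons_val_one,
    Matrix.cons_val_fin_one, Pi.smul_apply, smul_eq_mul, hsymm, hw0, hw1] at m0 m1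
  have hsin := sin_sub_eq_zero_of_eigenvector hρ hL0 hκ (hκ ▸ hκneg.ne) (by linarith)
    (by linarith)
  obtain ⟨n, hn⟩ := Real.sin_eq_zero_iff.mp hsin
  have hLα : L = α + n * Real.pi := by linarith
  have hexp : Tendsto (fun x => Real.exp (R x)) (𝓝[>] 0) (𝓝 0) :=
    Real.tendsto_exp_atBot.comp hRbot
  have hz0 : Tendsto z (𝓝[>] 0) (𝓝 0) := by
    refine squeeze_zero_norm' ?_ hexp
    filter_upwards [self_mem_nhdsWithin] with x hx
    obtain ⟨h0, h1⟩ := hpol x hx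
    refine (pi_norm_le_iff_of_nonneg (Real.exp_pos _).le).mpr fun i => ?_
    fin_cases i
    · change |z x 0| ≤ _
      rw [h0, abs_mul, Real.abs_exp]
      exact mul_le_of_le_one_right (Real.exp_pos _).le (Real.abs_cos_le_one _)
    · change |z x 1| ≤ _
      rw [h1, abs_mul, Real.abs_exp]
      exact mul_le_of_le_one_right (Real.exp_pos _).le (Real.abs_sin_le_one _)
  refine ⟨⟨hsol, hnt, hz0⟩, θ, n, b, ⟨?_, fun x hx => ?_⟩, hLα ▸ hL, hb⟩
  · exact fun x hx => (hθ x hx).continuousAt.continuousWithinAt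
  · exact ⟨_, Real.exp_pos _, hpol x hx⟩

/-- Subtracting `nπ` gives the normalized angle of `z` or `-z`, which starts at `α` and, by
uniqueness, ends at `ν(λ)`. The shift does not change the difference of the limits. -/
theorem hasRotationNumber_nu {μm μp : ℝ} {P : ℝ → Matrix (Fin 2) (Fin 2) ℝ} {β : ℝ}
    {Pstar : Matrix (Fin 2) (Fin 2) ℝ} (hP : ClassP μm μp P β Pstar)
    {w : Fin 2 → ℝ} (hCw : Cmat β Pstar *ᵥ w = sigmaMinus β Pstar • w)
    {α : ℝ} (hα : IsLineAngle w α) {lam : ℝ} (hlam : lam ∈ Ioo μm μp) {z : ℝ → Fin 2 → ℝ}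
    (hz : IsEigenfunction P lam z) : HasRotationNumber z ((nu P lam - α) / Real.pi) := by
  obtain ⟨hrec, θ, n, b, hang, hθ0, hθ1⟩ := exists_angle hP hCw hα hlam hz
  have h0 : Tendsto (fun x => θ x - n * Real.pi) (𝓝[>] 0) (𝓝 α) := by
    simpa using hθ0.sub_const ((n : ℝ) * Real.pi)
  have h1 : Tendsto (fun x => θ x - n * Real.pi) atTop (𝓝 (b - n * Real.pi)) :=
    hθ1.sub_const _
  have hnu : HasNu P lam (b - n * Real.pi) := by
    rcases hang.exists_sign n with h | h
    · exact ⟨z, _, α, hrec, h, h0, hα.1, h1⟩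
    · exact ⟨_, _, α, hrec.neg, h, h0, hα.1, h1⟩
  have hspec : HasNu P lam (nu P lam) := Classical.epsilon_spec ⟨_, hnu⟩
  have heq := hspec.unique hP.continuousOn hP.symm hnu
  refine ⟨θ, _, b, hang, hθ0, hθ1, ?_⟩
  rw [heq]
  ring

theorem rot_eq {z : ℝ → Fin 2 → ℝ} {s : ℝ} (h : HasRotationNumber z s) : rot z = s :=
  HasRotationNumber.unique (Classical.epsilon_spec ⟨s, h⟩) h

/-- Here `φ` is the arctangent term of `ν*`; it is positive because `λ > μ⁻` strictly. -/
theorem rot_eigenfunction_eq {μm μp : ℝ} {P : ℝ → Matrix (Fin 2) (Fin 2) ℝ} {β : ℝ}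
    {Pstar : Matrix (Fin 2) (Fin 2) ℝ} (hP : ClassP μm μp P β Pstar)
    {w : Fin 2 → ℝ} (hCw : Cmat β Pstar *ᵥ w = sigmaMinus β Pstar • w)
    {α : ℝ} (hα : IsLineAngle w α) {k : ℤ} {lam : ℝ} (hk : IsKthEigenvalue μm μp P k lam)
    {z : ℝ → Fin 2 → ℝ} (hz : IsEigenfunction P lam z) :
    HasRotationNumber z (rot z) ∧ ∃ φ ∈ Ioo 0 (Real.pi / 2),
      rot z * Real.pi = (k + 1) * Real.pi - φ - α := by
  have h := hasRotationNumber_nu hP hCw hα hk.1 hz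
  have hrot := rot_eq h
  refine ⟨hrot ▸ h, Real.arctan (Real.sqrt ((lam - μm) / (μp - lam))), ⟨?_, ?_⟩, ?_⟩
  · exact Real.arctan_pos.mpr (Real.sqrt_pos.mpr
      (div_pos (sub_pos.mpr hk.1.1) (sub_pos.mpr hk.1.2)))
  · exact Real.arctan_lt_pi_div_two _
  · have h2 := hk.2
    rw [nuStar] at h2
    rw [hrot, div_mul_cancel₀ _ Real.pi_pos.ne']
    linarith

end DiracSystem

theorem proposition3p5 (μm μp : ℝ) (hμ : μm < μp)
    (P : ℝ → Matrix (Fin 2) (Fin 2) ℝ) (β : ℝ) (Pstar : Matrix (Fin 2) (Fin 2) ℝ)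
    (hP : ClassP μm μp P β Pstar)
    (w : Fin 2 → ℝ) (hw : w ≠ 0) (hCw : Cmat β Pstar *ᵥ w = sigmaMinus β Pstar • w)
    (α : ℝ) (hα : IsLineAngle w α) :
    (∀ (k : ℤ) (lam : ℝ) (z : ℝ → Fin 2 → ℝ),
      IsKthEigenvalue μm μp P k lam → IsEigenfunction P lam z →
        HasRotationNumber z (rot z) ∧
        (α ∈ Set.Ioo 0 (Real.pi / 2) → rot z ∈ Set.Ioo (k : ℝ) (k + 1)) ∧
        (α ∈ Set.Ioo (Real.pi / 2) Real.pi →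
          rot z ∈ Set.Ioo ((k : ℝ) - 1 / 2) (k + 1 / 2))) ∧
    (∀ (k l : ℤ) (lam lam' : ℝ) (z z' : ℝ → Fin 2 → ℝ), k ≠ l →
      IsKthEigenvalue μm μp P k lam → IsEigenfunction P lam z →
      IsKthEigenvalue μm μp P l lam' → IsEigenfunction P lam' z' →
        rot z ≠ rot z') := by
  have hpi := Real.pi_pos
  refine ⟨fun k lam z hk hz => ?_, fun k l lam lam' z z' hkl hk hz hl hz' heq => ?_⟩
  · obtain ⟨hrot, φ, hφ, he⟩ := rot_eigenfunction_eq hP hCw hα hk hz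
    -- The sum `φ + α` lies in `(0, π)` in the first case and in `(π/2, 3π/2)` in the second.
    refine ⟨hrot, fun hα' => ⟨?_, ?_⟩, fun hα' => ⟨?_, ?_⟩⟩ <;>
      refine lt_of_mul_lt_mul_right ?_ hpi.le <;>
      nlinarith [hα'.1, hα'.2, hφ.1, hφ.2]
  · obtain ⟨-, φ, hφ, he⟩ := rot_eigenfunction_eq hP hCw hα hk hz
    obtain ⟨-, φ', hφ', he'⟩ := rot_eigenfunction_eq hP hCw hα hl hz'
    rw [heq] at he
    -- The common angle `α` cancels, and two values in `(0, π/2)` differ by less than `π`, so the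
    -- integer `k - l` must be `0`.
    have hdiff : ((k : ℝ) - l) * Real.pi = φ - φ' := by linarith
    have h1 : (k : ℝ) - l < 1 :=
      lt_of_mul_lt_mul_right (by linarith [hφ.2, hφ'.1]) hpi.le
    have h2 : -1 < (k : ℝ) - l :=
      lt_of_mul_lt_mul_right (by linarith [hφ.1, hφ'.2]) hpi.le
    have h1' : k - l < 1 := by exact_mod_cast h1
    have h2' : -1 < k - l := by exact_mod_cast h2
    omega
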